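/- Conventions. An $r$-graph $H$ on a finite vertex set $V(H)$ is a family of $r$-element subsets of $V(H)$, identified with its edge set. The expansion of a graph $G$ is the $r$-graph $G^+$ with edges $e\cup S_e$ ($e\in G$), where $|S_e|=r-2$, $S_e\cap V(G)=\emptyset$, and $S_e\cap S_{e'}=\emptyset$ for $e\neq e'$; its vertex set consists of $V(G)$ and all the sets $S_e$. We write $F\subset H$ if $H$ contains a copy of $F$, i.e. if there is an injection $V(F)\to V(H)$ mapping edges of $F$ to edges of $H$. A Delta-system is a hypergraph $\triangle$ such that $e\cap f=\bigcap_{g\in\triangle}g=:\mathrm{core}(\triangle)$ for all distinct $e,f\in\triangle$. For an $r$-graph $H$ and $f\subset V(H)$, the core degree $d^*_H(f)$ is the maximum number of edges of a Delta-system $\triangle\subset H$ with $\mathrm{core}(\triangle)=f$ (and $0$ if there is none). Lemma. For all integers $v\ge 1$ and $r\ge 4$ there exists a constant $c=c(v,r)$ such that the following holds. If $H$ is an $n$-vertex $r$-graph, $G$ is a forest with $v$ vertices, and $G^+\not\subset H$, then there is a partition $H=H_1\sqcup H_2$ of $H$ (parts may be empty) such that $$|H_1|\le c\binom{n-2}{r-2},$$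 and for every $f\in H_2$ there exists $x\in f$ such that $d^*_{H_2}(\{x,y\})\ge rv$ for all $y\in f\setminus\{x\}$. -/

import Mathlib

/-- A hypergraph on `V` is given by its edge set. It is an `r`-graph if all edges have `r`
elements. -/
def IsRGraph {V : Type*} (r : ℕ) (H : Finset (Finset V)) : Prop :=
  ∀ e ∈ H, e.card = r

/-- The edge `e ∪ S_e` of the `r`-expansion of `G`, where `S_e` consists of the `r - 2` new
vertices `(e, 0), …, (e, r - 3)`. -/
def expansionEdge {W : Type*} [DecidableEq W] (G : SimpleGraph W) (r : ℕ) (e : G.edgeSet) :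
    Finset (W ⊕ (G.edgeSet × Fin (r - 2))) :=
  (e : Sym2 W).toFinset.disjSum ({e} ×ˢ (Finset.univ : Finset (Fin (r - 2))))

/-- The (edge set of the) `r`-expansion `G⁺`; its vertex set consists of the vertices of `G`
and `r - 2` new vertices for each edge of `G`. -/
def expansion {W : Type*} [DecidableEq W] (G : SimpleGraph W) (r : ℕ) :
    Set (Finset (W ⊕ (G.edgeSet × Fin (r - 2)))) :=
  Set.range (expansionEdge G r)

/-- `F ⊂ H`: the hypergraph `H` contains a (not necessarily induced) copy of `F`. -/
def ContainsCopy {A B : Type*} (F : Set (Finset A)) (H : Finset (Finset B)) : Prop :=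
  ∃ φ : A ↪ B, ∀ f ∈ F, f.map φ ∈ H

/-- The intersection `⋂_{g ∈ D} g` of a family of subsets of `V` (which is `V` if `D = ∅`). -/
def core {V : Type*} [Fintype V] [DecidableEq V] (D : Finset (Finset V)) : Finset V :=
  Finset.univ.filter fun x => ∀ g ∈ D, x ∈ g

/-- Any two distinct edges of a Delta-system meet exactly in the intersection of all edges. -/
def IsDeltaSystem {V : Type*} [Fintype V] [DecidableEq V] (D : Finset (Finset V)) : Prop :=
  ∀ e ∈ D, ∀ f ∈ D, e ≠ f → e ∩ f = core D

open Classical in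
/-- The core degree `d*_H(f)`: the largest number of edges of a Delta-system `D ⊆ H` with
core `f` (and `0` if there is none). -/
noncomputable def coreDegree {V : Type*} [Fintype V] [DecidableEq V]
    (H : Finset (Finset V)) (f : Finset V) : ℕ :=
  (H.powerset.filter fun D => IsDeltaSystem D ∧ core D = f).sup Finset.card

/-!
The proof rests on Füredi's theorem on homogeneous subfamilies (`exists_isHomogeneous`): every
`r`-graph contains a positive proportion of its edges as a family `K` that is `r`-partite and in
which, as soon as two edges meet in a set using exactly the colours (parts) in `A`, the part of
*every* edge in the colours `A` is the core of a large Delta-system. An averaging argument over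
colourings makes the family `r`-partite. Then edges over sets of low core degree are deleted
repeatedly (`exists_cleaning`): if at least half of the edges survive, they form a homogeneous
family; if not, many edges were deleted because of one type `A`, and passing to popular further
vertices gives a dense subfamily in which no two edges meet in type `A`
(`IsRainbow.exists_notMem_intersectionTypes`). The number of types drops, so this stops.

The types of a homogeneous family are closed under intersection (`IsHomogeneous.inter_mem`). If some
`r - 2` colours lie in no type, edges are determined by their vertices of these colours and the
family has at most `n.choose (r - 2)` edges. Otherwise `exists_star_or_singletons` shows that the
types contain either all pairs through some colour, which is the property wanted for `H₂`, or two
singletons. In the latter case the expansion of any forest can be embedded greedily, vertex by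
vertex, with the vertices of the forest in these two colour classes
(`IsHomogeneous.exists_isPartialExpansion`), which is excluded.

Since the property wanted for `H₂` is preserved by unions, `H₂` is chosen maximal with it.
A homogeneous subfamily of `H \ H₂` is then of the first kind, hence it has at most
`n.choose (r - 2)` edges, and `H \ H₂` at most a constant times as many.
-/


/-! ### Core degrees -/

section CoreDegree

variable {V : Type*} [Fintype V] [DecidableEq V]

theorem le_coreDegree_iff {H : Finset (Finset V)} {f : Finset V} {s : ℕ} (hs : 0 < s) :
    s ≤ coreDegree H f ↔ ∃ D ⊆ H, IsDeltaSystem D ∧ core D = f ∧ s ≤ D.card := by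
  classical
  unfold coreDegree
  rw [Finset.le_sup_iff (by simpa using hs)]
  constructor
  · rintro ⟨D, hD, h⟩
    simp only [Finset.mem_filter, Finset.mem_powerset] at hD
    exact ⟨D, hD.1, hD.2.1, hD.2.2, h⟩
  · rintro ⟨D, h1, h2, h3, h4⟩
    exact ⟨D, by simp [h1, h2, h3], h4⟩

theorem coreDegree_mono {H H' : Finset (Finset V)} (h : H ⊆ H') (f : Finset V) :
    coreDegree H f ≤ coreDegree H' f := by
  rcases Nat.eq_zero_or_pos (coreDegree H f) with h0 | h0
  · omega
  · obtain ⟨D, hD, h1, h2, h3⟩ := (le_coreDegree_iff h0).1 le_rfl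
    exact (le_coreDegree_iff h0).2 ⟨D, hD.trans h, h1, h2, h3⟩

theorem core_subset {D : Finset (Finset V)} {g : Finset V} (hg : g ∈ D) : core D ⊆ g := by
  intro x hx
  simp only [core, Finset.mem_filter] at hx
  exact hx.2 g hg

/-- A family with at least two members, any two of which meet exactly in `f`, is a Delta-system
with core `f`. -/
theorem core_eq_of_pairwise_inter {D : Finset (Finset V)} {f : Finset V} (hD : 1 < D.card)
    (h : ∀ d ∈ D, ∀ e ∈ D, d ≠ e → d ∩ e = f) : core D = f := by
  obtain ⟨a, ha, b, hb, hab⟩ := Finset.one_lt_card.1 hD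
  apply Finset.Subset.antisymm
  · rw [← h a ha b hb hab]
    exact Finset.subset_inter (core_subset ha) (core_subset hb)
  · intro x hx
    simp only [core, Finset.mem_filter, Finset.mem_univ, true_and]
    intro g hg
    by_cases hga : g = a
    · subst hga
      rw [← h g ha b hb hab] at hx
      exact Finset.mem_of_mem_inter_left hx
    · rw [← h g hg a ha hga] at hx
      exact Finset.mem_of_mem_inter_left hx

/-- A small set can be avoided, outside the core, by some edge of a large Delta-system: the sets
`g \ f` are pairwise disjoint, so that each point of `X` lies in at most one of them. -/
theorem exists_inter_subset_of_card_lt {H : Finset (Finset V)} {f X : Finset V}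
    (h : X.card < coreDegree H f) : ∃ g ∈ H, f ⊆ g ∧ g ∩ X ⊆ f := by
  obtain ⟨D, hDH, hD, hf, hc⟩ := (le_coreDegree_iff (by omega)).1 h
  by_contra! hcon
  have key : ∀ g ∈ D, ∃ x ∈ X, x ∈ g ∧ x ∉ f := by
    intro g hg
    have := hcon g (hDH hg) (hf ▸ core_subset hg)
    obtain ⟨x, hx, hxf⟩ := Finset.not_subset.1 this
    rw [Finset.mem_inter] at hx
    exact ⟨x, hx.2, hx.1, hxf⟩
  choose p hpX hpg hpf using key
  have : D.card ≤ X.card := by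
    rw [← Finset.card_attach (s := D)]
    refine Finset.card_le_card_of_injOn (fun g => p g.1 g.2) (fun g _ => hpX g.1 g.2) ?_
    intro a _ b _ hab
    by_contra hne
    have hi := hD a a.2 b b.2 fun h => hne (Subtype.ext h)
    apply hpf a a.2
    rw [← hf, ← hi, Finset.mem_inter]
    exact ⟨hpg a a.2, (show p a a.2 = p b b.2 from hab) ▸ hpg b b.2⟩
  omega

/-- If no large Delta-system with core `f` exists among the edges of `L`, all of which properly
contain `f`, then many edges of `L` share a vertex outside `f`: the petals of a maximal
Delta-system with core `f` meet every edge of `L` outside `f`. -/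
theorem exists_popular_vertex {L : Finset (Finset V)} {f : Finset V} {r s : ℕ}
    (hL : L.Nonempty) (hr : ∀ e ∈ L, e.card ≤ r) (hf : ∀ e ∈ L, f ⊂ e) (hs : 2 ≤ s)
    (hc : coreDegree L f < s) :
    ∃ t ∉ f, L.card ≤ r * s * (L.filter fun e => t ∈ e).card := by
  classical
  let P : Finset (Finset V) → Prop := fun D => D ⊆ L ∧ ∀ d ∈ D, ∀ e ∈ D, d ≠ e → d ∩ e = f
  obtain ⟨D, hD⟩ := (Set.toFinite {D | P D}).exists_maximal ⟨∅, by simp [P]⟩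
  obtain ⟨⟨hDL, hDp⟩, hmax⟩ := hD
  have hDs : D.card ≤ s := by
    by_contra! h
    have hcore := core_eq_of_pairwise_inter (by omega) hDp
    have : s ≤ coreDegree L f :=
      (le_coreDegree_iff (by omega)).2 ⟨D, hDL, fun a ha b hb hab => by
        rw [hcore]; exact hDp a ha b hb hab, hcore, by omega⟩
    omega
  set T := (D.biUnion id) \ f with hT
  have hTc : T.card ≤ r * s := by
    calc T.card ≤ (D.biUnion id).card := Finset.card_le_card Finset.sdiff_subset
      _ ≤ D.card * r := Finset.card_biUnion_le_card_mul _ _ _ fun e he => hr e (hDL he)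
      _ ≤ s * r := Nat.mul_le_mul_right _ hDs
      _ = r * s := mul_comm _ _
  have hit : ∀ e ∈ L, ∃ t ∈ T, t ∈ e := by
    intro e he
    by_cases heD : e ∈ D
    · obtain ⟨t, ht, htf⟩ := Finset.exists_of_ssubset (hf e he)
      exact ⟨t, Finset.mem_sdiff.2 ⟨Finset.mem_biUnion.2 ⟨e, heD, ht⟩, htf⟩, ht⟩
    · have hnot : ¬ P (insert e D) := by
        intro hP
        exact heD (hmax hP (Finset.subset_insert _ _) (Finset.mem_insert_self _ _))
      have hex : ∃ d ∈ D, d ∩ e ≠ f := by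
        by_contra! hall
        apply hnot
        refine ⟨Finset.insert_subset he hDL, ?_⟩
        intro a ha b hb hab
        rw [Finset.mem_insert] at ha hb
        rcases ha with rfl | ha <;> rcases hb with rfl | hb
        · exact absurd rfl hab
        · rw [Finset.inter_comm]; exact hall b hb
        · exact hall a ha
        · exact hDp a ha b hb hab
      obtain ⟨d, hd, hne⟩ := hex
      have hsub : f ⊂ d ∩ e := (Finset.subset_inter (hf d (hDL hd)).1 (hf e he).1).ssubset_of_ne
        (Ne.symm hne)
      obtain ⟨t, ht, htf⟩ := Finset.exists_of_ssubset hsub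
      rw [Finset.mem_inter] at ht
      exact ⟨t, Finset.mem_sdiff.2 ⟨Finset.mem_biUnion.2 ⟨d, hd, ht.1⟩, htf⟩, ht.2⟩
  by_contra! hcon
  obtain ⟨e₀, he₀⟩ := hL
  obtain ⟨t₀, -⟩ := hit e₀ he₀
  have : Nonempty V := ⟨t₀⟩
  choose! p hpT hpe using hit
  have hTne : T.Nonempty := ⟨p e₀, hpT e₀ he₀⟩
  have hsum : L.card = ∑ t ∈ T, (L.filter fun e => p e = t).card :=
    Finset.card_eq_sum_card_fiberwise fun e he => hpT e he
  have hlt : r * s * L.card < T.card * L.card := by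
    rw [hsum, Finset.mul_sum, ← hsum, ← smul_eq_mul (T.card), ← Finset.sum_const]
    apply Finset.sum_lt_sum_of_nonempty hTne
    intro t ht
    refine lt_of_le_of_lt (Nat.mul_le_mul_left _ (Finset.card_le_card ?_))
      (hcon t (Finset.mem_sdiff.1 ht).2)
    intro e he
    rw [Finset.mem_filter] at he ⊢
    exact ⟨he.1, he.2 ▸ hpe e he.1⟩
  exact absurd (Nat.mul_le_mul_right L.card hTc) (not_le.2 hlt)

end CoreDegree

/-! ### Rainbow families and types of intersections -/

section Rainbow

variable {V : Type*} {r : ℕ}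

/-- Every edge of `H` has exactly one vertex of each of the `r` colours of `χ`, so that `H` is an
`r`-partite `r`-graph whose parts are the colour classes. -/
def IsRainbow (χ : V → Fin r) (H : Finset (Finset V)) : Prop :=
  ∀ e ∈ H, e.card = r ∧ Set.InjOn χ e

/-- The vertices of `e` whose colours lie in `A`. -/
def proj (χ : V → Fin r) (e : Finset V) (A : Finset (Fin r)) : Finset V :=
  e.filter fun x => χ x ∈ A

variable {χ : V → Fin r} {H H' : Finset (Finset V)} {e e' f : Finset V} {A B : Finset (Fin r)}

theorem mem_proj {x : V} : x ∈ proj χ e A ↔ x ∈ e ∧ χ x ∈ A := Finset.mem_filter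

theorem proj_subset : proj χ e A ⊆ e := Finset.filter_subset _ _

theorem IsRainbow.mono (hH : IsRainbow χ H') (h : H ⊆ H') : IsRainbow χ H := fun e he => hH e (h he)

theorem IsRainbow.image_eq_univ (hH : IsRainbow χ H) (he : e ∈ H) : e.image χ = Finset.univ := by
  apply Finset.eq_univ_of_card
  rw [Finset.card_image_of_injOn (hH e he).2, (hH e he).1, Fintype.card_fin]

theorem IsRainbow.exists_mem (hH : IsRainbow χ H) (he : e ∈ H) (i : Fin r) : ∃ x ∈ e, χ x = i := by
  have : i ∈ e.image χ := by rw [hH.image_eq_univ he]; exact Finset.mem_univ _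
  simpa using this

theorem IsRainbow.image_proj (hH : IsRainbow χ H) (he : e ∈ H) (A : Finset (Fin r)) :
    (proj χ e A).image χ = A := by
  ext i
  simp only [Finset.mem_image, mem_proj]
  constructor
  · rintro ⟨x, ⟨-, h⟩, rfl⟩; exact h
  · intro hi
    obtain ⟨x, hx, rfl⟩ := hH.exists_mem he i
    exact ⟨x, ⟨hx, hi⟩, rfl⟩

theorem IsRainbow.card_proj (hH : IsRainbow χ H) (he : e ∈ H) (A : Finset (Fin r)) :
    (proj χ e A).card = A.card := by
  conv_rhs => rw [← hH.image_proj he A]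
  rw [Finset.card_image_of_injOn]
  exact (hH e he).2.mono (Finset.coe_subset.2 proj_subset)

theorem IsRainbow.proj_image (hH : IsRainbow χ H) (he : e ∈ H) (hf : f ⊆ e) :
    proj χ e (f.image χ) = f := by
  ext x
  simp only [mem_proj, Finset.mem_image]
  constructor
  · rintro ⟨hx, y, hy, hxy⟩
    rwa [← (hH e he).2 (hf hy) hx hxy]
  · intro hx
    exact ⟨hf hx, x, hx, rfl⟩

variable [DecidableEq V]

open Classical in
/-- The colour sets of the intersections of two distinct edges of `H`. -/
noncomputable def intersectionTypes (χ : V → Fin r) (H : Finset (Finset V)) :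
    Finset (Finset (Fin r)) :=
  Finset.univ.filter fun A => ∃ e ∈ H, ∃ e' ∈ H, e ≠ e' ∧ (e ∩ e').image χ = A

theorem mem_intersectionTypes :
    A ∈ intersectionTypes χ H ↔ ∃ e ∈ H, ∃ e' ∈ H, e ≠ e' ∧ (e ∩ e').image χ = A := by
  simp [intersectionTypes]

theorem intersectionTypes_mono (h : H ⊆ H') : intersectionTypes χ H ⊆ intersectionTypes χ H' := by
  intro A hA
  rw [mem_intersectionTypes] at hA ⊢
  obtain ⟨e, he, e', he', h'⟩ := hA
  exact ⟨e, h he, e', h he', h'⟩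

theorem IsRainbow.ne_univ (hH : IsRainbow χ H) (hA : A ∈ intersectionTypes χ H) :
    A ≠ Finset.univ := by
  rw [mem_intersectionTypes] at hA
  obtain ⟨e, he, e', he', hne, hi⟩ := hA
  rintro rfl
  apply hne
  have h1 : (e ∩ e').card = r := by
    rw [← Finset.card_image_of_injOn ((hH e he).2.mono (by simp)), hi]; simp
  have h2 : e ∩ e' = e := Finset.eq_of_subset_of_card_le Finset.inter_subset_left
    (by rw [h1, (hH e he).1])
  have h3 : e ∩ e' = e' := Finset.eq_of_subset_of_card_le Finset.inter_subset_right
    (by rw [h1, (hH e' he').1])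
  rw [← h2, h3]

theorem proj_subset_inter (h : proj χ e A = proj χ e' A) : proj χ e A ⊆ e ∩ e' := by
  refine Finset.subset_inter proj_subset ?_
  rw [h]; exact proj_subset

variable [Fintype V]

/-- A rainbow family is `s`-homogeneous if, whenever two edges meet in a set with colour set `A`,
the part of *every* edge with colours in `A` has core degree at least `s`. -/
def IsHomogeneous (s : ℕ) (χ : V → Fin r) (H : Finset (Finset V)) : Prop :=
  ∀ A ∈ intersectionTypes χ H, ∀ e ∈ H, s ≤ coreDegree H (proj χ e A)

/-- The family of types of intersections of a homogeneous family is closed under intersection. -/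
theorem IsHomogeneous.inter_mem {s : ℕ} (hH : IsRainbow χ H) (hom : IsHomogeneous s χ H)
    (hs : 2 * r < s) (hA : A ∈ intersectionTypes χ H) (hB : B ∈ intersectionTypes χ H) :
    A ∩ B ∈ intersectionTypes χ H := by
  obtain ⟨e, he, -⟩ := mem_intersectionTypes.1 hA
  -- An edge `g` meeting `e` in type `A`, and then an edge `h` whose intersection with `e` has
  -- type `B` and which avoids `g` otherwise: their intersection has type `A ∩ B`.
  obtain ⟨g, hg, hAg, hge⟩ := exists_inter_subset_of_card_lt (X := e)
    (lt_of_lt_of_le (by rw [(hH e he).1]; omega) (hom A hA e he))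
  obtain ⟨h, hh, hBh, hhX⟩ := exists_inter_subset_of_card_lt (X := e ∪ g)
    (lt_of_lt_of_le (lt_of_le_of_lt (Finset.card_union_le _ _)
      (by rw [(hH e he).1, (hH g hg).1]; omega)) (hom B hB e he))
  have hgh : g ∩ h = proj χ e (A ∩ B) := by
    ext x
    simp only [Finset.mem_inter, mem_proj]
    constructor
    · rintro ⟨hxg, hxh⟩
      have h1 := mem_proj.1 (hhX (Finset.mem_inter.2 ⟨hxh, Finset.mem_union_right _ hxg⟩))
      have h2 := mem_proj.1 (hge (Finset.mem_inter.2 ⟨hxg, h1.1⟩))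
      exact ⟨h1.1, h2.2, h1.2⟩
    · rintro ⟨hxe, hxA, hxB⟩
      exact ⟨hAg (mem_proj.2 ⟨hxe, hxA⟩), hBh (mem_proj.2 ⟨hxe, hxB⟩)⟩
  refine mem_intersectionTypes.2 ⟨g, hg, h, hh, ?_, by rw [hgh, hH.image_proj he]⟩
  rintro rfl
  have h1 := (hH g hg).1
  rw [Finset.inter_self] at hgh
  rw [hgh, hH.card_proj he] at h1
  have h2 : A ∩ B = Finset.univ := Finset.eq_univ_of_card _ (by rw [h1, Fintype.card_fin])
  exact hH.ne_univ hA (Finset.eq_univ_of_forall fun i =>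
    (Finset.mem_inter.1 (h2 ▸ Finset.mem_univ i)).1)

/-- An `r`-graph has a rainbow subfamily of proportion at least `r ^ (-r)` for some colouring. -/
theorem exists_isRainbow (hr : 0 < r) (hH : IsRGraph r H) :
    ∃ (χ : V → Fin r) (H' : Finset (Finset V)), H' ⊆ H ∧ IsRainbow χ H' ∧
      H.card ≤ r ^ r * H'.card := by
  classical
  have : Nonempty (Fin r) := ⟨⟨0, hr⟩⟩
  let R : (V → Fin r) → Finset (Finset V) := fun χ => H.filter fun e => Set.InjOn χ e
  have hedge : ∀ e ∈ H, Fintype.card (V → Fin r) ≤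
      r ^ r * (Finset.univ.filter fun χ : V → Fin r => Set.InjOn χ e).card := by
    intro e he
    -- Recolouring `e` by a fixed bijection is a map with fibres of size at most `r ^ r`.
    let σ : e ≃ Fin r := e.equivFinOfCardEq (hH e he)
    let F : (V → Fin r) → (e → Fin r) × (V → Fin r) := fun χ =>
      (fun x => χ x, fun x => if hx : x ∈ e then σ ⟨x, hx⟩ else χ x)
    have hF : Function.Injective F := by
      intro χ χ' h
      simp only [F, Prod.mk.injEq] at h
      funext x
      by_cases hx : x ∈ e
      · exact congrFun h.1 ⟨x, hx⟩
      · simpa [hx] using congrFun h.2 x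
    have := Finset.card_le_card_of_injOn (s := Finset.univ)
      (t := (Finset.univ : Finset (e → Fin r)) ×ˢ
        (Finset.univ.filter fun χ : V → Fin r => Set.InjOn χ e)) F (by
          intro χ _
          simp only [Finset.coe_product, Set.mem_prod, Finset.coe_univ, Set.mem_univ, true_and,
            Finset.mem_coe, Finset.mem_filter, Finset.mem_univ]
          intro x hx y hy hxy
          rw [Finset.mem_coe] at hx hy
          simp only [F, hx, hy, dif_pos] at hxy
          simpa using σ.injective hxy) hF.injOn
    rw [Finset.card_product] at this
    simpa [hH e he] using this
  by_contra! hcon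
  have hlt : ∀ χ, r ^ r * (R χ).card < H.card := fun χ =>
    hcon χ (R χ) (Finset.filter_subset _ _) fun e he =>
      ⟨hH e (Finset.mem_filter.1 he).1, (Finset.mem_filter.1 he).2⟩
  have h1 : ∑ χ : V → Fin r, (R χ).card =
      ∑ e ∈ H, (Finset.univ.filter fun χ : V → Fin r => Set.InjOn χ e).card := by
    exact Finset.sum_card_bipartiteAbove_eq_sum_card_bipartiteBelow
      (s := Finset.univ) (t := H) fun (χ : V → Fin r) (e : Finset V) => Set.InjOn χ e
  have h2 : ∑ χ : V → Fin r, r ^ r * (R χ).card < ∑ χ : V → Fin r, H.card :=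
    Finset.sum_lt_sum_of_nonempty Finset.univ_nonempty fun χ _ => hlt χ
  have h3 : ∑ e ∈ H, Fintype.card (V → Fin r) ≤ ∑ e ∈ H,
      r ^ r * (Finset.univ.filter fun χ : V → Fin r => Set.InjOn χ e).card :=
    Finset.sum_le_sum hedge
  rw [← Finset.mul_sum, h1, Finset.mul_sum] at h2
  have h4 := lt_of_le_of_lt h3 h2
  simp only [Finset.sum_const, smul_eq_mul, Finset.card_univ] at h4
  rw [mul_comm] at h4
  exact lt_irrefl _ h4

end Rainbow

/-! ### Homogeneous subfamilies -/

section Homogeneous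

variable {V : Type*} [Fintype V] [DecidableEq V] {r s : ℕ} {χ : V → Fin r}
  {H : Finset (Finset V)}

/-- Deleting, one after the other, all edges over a set `proj χ e A`, `A ∈ 𝒜`, of core degree less
than `s` leads to a subfamily `H₀` without such sets. The edges deleted because of `A` form a
family `B A` whose members with a common projection to `A` contain no large Delta-system with that
projection as core. -/
theorem exists_cleaning (χ : V → Fin r) (s : ℕ) (𝒜 : Finset (Finset (Fin r)))
    (H : Finset (Finset V)) :
    ∃ H₀ ⊆ H, (∀ A ∈ 𝒜, ∀ e ∈ H₀, s ≤ coreDegree H₀ (proj χ e A)) ∧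
      ∃ B : Finset (Fin r) → Finset (Finset V), (∀ A, B A ⊆ H) ∧ H \ H₀ ⊆ 𝒜.biUnion B ∧
        ∀ A ∈ 𝒜, ∀ e ∈ B A,
          coreDegree ((B A).filter fun g => proj χ g A = proj χ e A) (proj χ e A) < s := by
  induction H using Finset.strongInduction with
  | H H ih =>
  by_cases hgood : ∀ A ∈ 𝒜, ∀ e ∈ H, s ≤ coreDegree H (proj χ e A)
  · exact ⟨H, subset_rfl, hgood, fun _ => ∅, by simp, by simp, by simp⟩
  push Not at hgood
  obtain ⟨A₀, hA₀, e₀, he₀, hlt⟩ := hgood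
  set L := H.filter fun g => proj χ g A₀ = proj χ e₀ A₀ with hL
  have hLH : L ⊆ H := Finset.filter_subset _ _
  have he₀L : e₀ ∈ L := by simp [hL, he₀]
  obtain ⟨H₀, hH₀, hg, B, hBH, hcov, hB⟩ :=
    ih (H \ L) (Finset.sdiff_ssubset hLH ⟨e₀, he₀L⟩)
  refine ⟨H₀, hH₀.trans Finset.sdiff_subset, hg,
    fun A => if A = A₀ then B A ∪ L else B A, ?_, ?_, ?_⟩
  · intro A
    dsimp only
    split_ifs
    · exact Finset.union_subset ((hBH A).trans Finset.sdiff_subset) hLH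
    · exact (hBH A).trans Finset.sdiff_subset
  · intro e he
    rw [Finset.mem_sdiff] at he
    rw [Finset.mem_biUnion]
    by_cases heL : e ∈ L
    · exact ⟨A₀, hA₀, by simp [heL]⟩
    · obtain ⟨A, hA, heA⟩ := Finset.mem_biUnion.1
        (hcov (Finset.mem_sdiff.2 ⟨Finset.mem_sdiff.2 ⟨he.1, heL⟩, he.2⟩))
      refine ⟨A, hA, ?_⟩
      split_ifs
      · exact Finset.mem_union_left _ heA
      · exact heA
  · intro A hA e he
    dsimp only at he ⊢
    split_ifs at he ⊢ with hAA
    · subst hAA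
      by_cases hf : proj χ e A = proj χ e₀ A
      · rw [hf]
        refine lt_of_le_of_lt (coreDegree_mono ?_ _) hlt
        exact (Finset.filter_subset _ _).trans
          (Finset.union_subset ((hBH A).trans Finset.sdiff_subset) hLH)
      · have heB : e ∈ B A := by
          rcases Finset.mem_union.1 he with h | h
          · exact h
          · exact absurd (Finset.mem_filter.1 h).2 hf
        refine lt_of_le_of_lt (coreDegree_mono ?_ _) (hB A hA e heB)
        intro g hg
        rw [Finset.mem_filter] at hg ⊢
        refine ⟨?_, hg.2⟩
        rcases Finset.mem_union.1 hg.1 with h | h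
        · exact h
        · exact absurd (hg.2.symm.trans (Finset.mem_filter.1 h).2) hf
    · exact hB A hA e he

/-- If no set `proj χ e A` is the core of a large Delta-system among the edges with that projection,
then a positive proportion of the edges forms a family in which no two edges meet in type `A`:
over each projection to `A` keep only the edges through one further popular vertex. -/
theorem IsRainbow.exists_notMem_intersectionTypes {B : Finset (Finset V)}
    (hB : IsRainbow χ B) {A : Finset (Fin r)} (hA : A ≠ Finset.univ) (hs : 2 ≤ s)
    (hlow : ∀ e ∈ B, coreDegree (B.filter fun g => proj χ g A = proj χ e A) (proj χ e A) < s) :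
    ∃ H' ⊆ B, A ∉ intersectionTypes χ H' ∧ B.card ≤ r * s * H'.card := by
  rcases B.eq_empty_or_nonempty with rfl | ⟨e₀, he₀⟩
  · exact ⟨∅, subset_rfl, by simp [mem_intersectionTypes], by simp⟩
  have hpop : ∀ f ∈ B.image fun e => proj χ e A, ∃ t ∉ f,
      (B.filter fun g => proj χ g A = f).card ≤
        r * s * ((B.filter fun g => proj χ g A = f).filter fun g => t ∈ g).card := by
    intro f hf
    obtain ⟨e, he, rfl⟩ := Finset.mem_image.1 hf
    refine exists_popular_vertex ⟨e, by simp [he]⟩ ?_ ?_ hs (hlow e he)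
    · intro g hg
      exact (hB g (Finset.mem_filter.1 hg).1).1.le
    · intro g hg
      obtain ⟨hgB, hg⟩ := Finset.mem_filter.1 hg
      rw [← hg]
      refine proj_subset.ssubset_of_ne fun h => hA ?_
      rw [← hB.image_proj hgB A, h, hB.image_eq_univ hgB]
  obtain ⟨t₀, -⟩ := hpop _ (Finset.mem_image_of_mem _ he₀)
  have : Nonempty V := ⟨t₀⟩
  choose! t htf ht using hpop
  refine ⟨B.filter fun g => t (proj χ g A) ∈ g, Finset.filter_subset _ _, ?_, ?_⟩
  · intro hmem
    obtain ⟨e, he, e', he', -, hi⟩ := mem_intersectionTypes.1 hmem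
    rw [Finset.mem_filter] at he he'
    have h1 : proj χ e A = e ∩ e' := by
      rw [← hi]; exact hB.proj_image he.1 Finset.inter_subset_left
    have h2 : proj χ e' A = e ∩ e' := by
      rw [← hi]; exact hB.proj_image he'.1 Finset.inter_subset_right
    apply htf (proj χ e A) (Finset.mem_image_of_mem _ he.1)
    rw [h1]
    exact Finset.mem_inter.2 ⟨h1 ▸ he.2, h2 ▸ he'.2⟩
  · rw [Finset.card_eq_sum_card_fiberwise (f := fun e => proj χ e A)
        (t := B.image fun e => proj χ e A) fun e he => Finset.mem_image_of_mem _ he,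
      Finset.card_eq_sum_card_fiberwise (s := B.filter _) (f := fun e => proj χ e A)
        (t := B.image fun e => proj χ e A)
        fun e he => Finset.mem_image_of_mem _ (Finset.mem_filter.1 he).1, Finset.mul_sum]
    refine Finset.sum_le_sum fun f hf => (ht f hf).trans (Nat.mul_le_mul_left _ ?_)
    apply Finset.card_le_card
    intro g hg
    simp only [Finset.mem_filter] at hg ⊢
    exact ⟨⟨hg.1.1, by rw [hg.1.2]; exact hg.2⟩, hg.1.2⟩

/-- A rainbow family has a homogeneous subfamily of positive proportion: either the family left by
the cleaning is large, or one of the possible types of intersections can be eliminated. -/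
theorem IsRainbow.exists_isHomogeneous (hs : 2 ≤ s) (k : ℕ) (hH : IsRainbow χ H)
    (hk : (intersectionTypes χ H).card ≤ k) :
    ∃ H' ⊆ H, IsHomogeneous s χ H' ∧ H.card ≤ (2 * (2 ^ r * (r * s)) + 2) ^ k * H'.card := by
  set M := 2 * (2 ^ r * (r * s)) + 2 with hM
  induction k generalizing H with
  | zero =>
    rw [Nat.le_zero, Finset.card_eq_zero] at hk
    exact ⟨H, subset_rfl, fun A hA => by simp [hk] at hA, by simp⟩
  | succ k ih =>
    obtain ⟨H₀, hH₀, hg, B, hBH, hcov, hB⟩ := exists_cleaning χ s (intersectionTypes χ H) H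
    have hsplit : H.card = (H \ H₀).card + H₀.card := (Finset.card_sdiff_add_card_eq_card hH₀).symm
    by_cases hlarge : H.card ≤ 2 * H₀.card
    · refine ⟨H₀, hH₀, fun A hA => hg A (intersectionTypes_mono hH₀ hA), hlarge.trans ?_⟩
      apply Nat.mul_le_mul_right
      calc 2 ≤ M := by omega
        _ ≤ M ^ (k + 1) := Nat.le_self_pow (by omega) M
    · -- Some type accounts for a positive proportion of the deleted edges.
      have hsum : (H \ H₀).card ≤ ∑ A ∈ intersectionTypes χ H, (B A).card :=
        (Finset.card_le_card hcov).trans Finset.card_biUnion_le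
      have hne : (intersectionTypes χ H).Nonempty := by
        by_contra h
        rw [Finset.not_nonempty_iff_eq_empty] at h
        rw [h, Finset.sum_empty] at hsum
        omega
      obtain ⟨A, hA, hmax⟩ := Finset.exists_max_image _ (fun A => (B A).card) hne
      have hcard : (intersectionTypes χ H).card ≤ 2 ^ r := by
        refine (Finset.card_le_univ _).trans ?_
        rw [Fintype.card_finset, Fintype.card_fin]
      have hBA : H.card ≤ 2 * (2 ^ r * (B A).card) := by
        have h1 := (hsum.trans (Finset.sum_le_card_nsmul _ _ _ hmax)).trans
          (Nat.mul_le_mul_right _ hcard)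
        omega
      obtain ⟨H₁, hH₁, hAH₁, hc₁⟩ :=
        (hH.mono (hBH A)).exists_notMem_intersectionTypes (hH.ne_univ hA) hs (hB A hA)
      have hH₁H := hH₁.trans (hBH A)
      have hk' : (intersectionTypes χ H₁).card ≤ k := by
        have : (intersectionTypes χ H₁).card < (intersectionTypes χ H).card :=
          Finset.card_lt_card ⟨intersectionTypes_mono hH₁H, fun h => hAH₁ (h hA)⟩
        omega
      obtain ⟨H', hH', hom, hc⟩ := ih (hH.mono hH₁H) hk'
      refine ⟨H', hH'.trans hH₁H, hom, ?_⟩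
      calc H.card ≤ 2 * (2 ^ r * (r * s * H₁.card)) := hBA.trans (by gcongr)
        _ = 2 * (2 ^ r * (r * s)) * H₁.card := by ring
        _ ≤ M * (M ^ k * H'.card) := Nat.mul_le_mul (by omega) hc
        _ = M ^ (k + 1) * H'.card := by ring

end Homogeneous

/-- **Füredi's theorem**: every `r`-graph contains a rainbow homogeneous subfamily of proportion
bounded below in terms of `r` and `s`. -/
theorem exists_isHomogeneous (r s : ℕ) (hr : 0 < r) (hs : 2 ≤ s) :
    ∃ N : ℕ, ∀ (V : Type*) [Fintype V] [DecidableEq V] (H : Finset (Finset V)), IsRGraph r H →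
      ∃ (χ : V → Fin r) (H' : Finset (Finset V)), H' ⊆ H ∧ IsRainbow χ H' ∧
        IsHomogeneous s χ H' ∧ H.card ≤ N * H'.card := by
  refine ⟨r ^ r * (2 * (2 ^ r * (r * s)) + 2) ^ 2 ^ r, fun V _ _ H hH => ?_⟩
  obtain ⟨χ, H₁, hH₁, hrain, hc₁⟩ := exists_isRainbow hr hH
  obtain ⟨H', hH', hom, hc⟩ := hrain.exists_isHomogeneous hs (2 ^ r)
    ((Finset.card_le_univ _).trans (by simp))
  refine ⟨χ, H', hH'.trans hH₁, hrain.mono hH', hom, hc₁.trans ?_⟩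
  rw [mul_assoc]
  exact Nat.mul_le_mul_left _ hc

/-! ### Families of types closed under intersection -/

/-- Let `𝒥` be closed under intersection, and let every complement of a pair lie in a proper member
of `𝒥`. In terms of the set `U` of points whose complement is not in `𝒥`: every proper subset whose
complement does not meet `U` in exactly one point is in `𝒥`. So the pairs through `x` are in `𝒥` if
`U = {x}`, and at least two singletons are in `𝒥` otherwise. -/
theorem exists_star_or_singletons {κ : Type*} [Fintype κ] [DecidableEq κ]
    (hκ : 4 ≤ Fintype.card κ) {𝒥 : Finset (Finset κ)}
    (hinter : ∀ A ∈ 𝒥, ∀ B ∈ 𝒥, A ∩ B ∈ 𝒥)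
    (hcov : ∀ a b, a ≠ b → {a}ᶜ ∈ 𝒥 ∨ {b}ᶜ ∈ 𝒥 ∨ ({a, b} : Finset κ)ᶜ ∈ 𝒥) :
    (∃ x, ∀ y, y ≠ x → {x, y} ∈ 𝒥) ∨ ∃ m m', m ≠ m' ∧ {m} ∈ 𝒥 ∧ {m'} ∈ 𝒥 := by
  set U : Finset κ := Finset.univ.filter fun a => ({a} : Finset κ)ᶜ ∉ 𝒥 with hU
  have key : ∀ S : Finset κ, S ≠ Finset.univ → (Sᶜ ∩ U).card ≠ 1 → S ∈ 𝒥 := by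
    intro S hS hSU
    have hne : Sᶜ.Nonempty := by
      rwa [Finset.nonempty_iff_ne_empty, Ne, Finset.compl_eq_empty_iff]
    have hk : ∀ a ∈ Sᶜ, ∃ k : Finset κ, a ∈ k ∧ k ⊆ Sᶜ ∧ kᶜ ∈ 𝒥 := by
      intro a ha
      by_cases haU : a ∈ U
      · obtain ⟨b, hb, hba⟩ : ∃ b ∈ Sᶜ ∩ U, b ≠ a := by
          by_contra! hall
          exact hSU (Finset.card_eq_one.2 ⟨a, Finset.eq_singleton_iff_unique_mem.2
            ⟨Finset.mem_inter.2 ⟨ha, haU⟩, hall⟩⟩)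
        rw [Finset.mem_inter] at hb
        have h1 : ({a} : Finset κ)ᶜ ∉ 𝒥 := by simpa [hU] using haU
        have h2 : ({b} : Finset κ)ᶜ ∉ 𝒥 := by simpa [hU] using hb.2
        refine ⟨{a, b}, by simp, ?_, by have := hcov a b hba.symm; tauto⟩
        intro x hx
        rw [Finset.mem_insert, Finset.mem_singleton] at hx
        rcases hx with rfl | rfl
        · exact ha
        · exact hb.1
      · exact ⟨{a}, by simp, by simpa using ha, by simpa [hU] using haU⟩
    choose! k hak hkS hk using hk
    have hsup : Sᶜ.sup' hne k = Sᶜ := by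
      apply le_antisymm
      · exact Finset.sup'_le _ _ hkS
      · intro a ha
        exact (Finset.le_sup' k ha : k a ⊆ _) (hak a ha)
    have := Finset.sup'_mem {T : Finset κ | Tᶜ ∈ 𝒥} (fun T hT T' hT' => by
      simp only [Set.mem_ofPred_eq, Finset.sup_eq_union, Finset.compl_union] at *
      exact hinter _ hT _ hT') Sᶜ hne k hk
    rw [hsup] at this
    simpa using this
  have hne_univ : ∀ S : Finset κ, S.card ≤ 2 → S ≠ Finset.univ := by
    rintro S hS rfl
    rw [Finset.card_univ] at hS
    omega
  by_cases h1 : U.card = 1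
  · obtain ⟨x, hx⟩ := Finset.card_eq_one.1 h1
    refine Or.inl ⟨x, fun y _ => key _ (hne_univ _ Finset.card_le_two) ?_⟩
    have : ({x, y} : Finset κ)ᶜ ∩ U = ∅ := by
      rw [hx]; ext z; simp
    rw [this]; simp
  · right
    have hsing : ∀ m, (U.card = 2 → m ∉ U) → {m} ∈ 𝒥 := by
      intro m hm
      refine key _ (hne_univ _ (by simp)) ?_
      have : ({m} : Finset κ)ᶜ ∩ U = U.erase m := by
        ext z; simp
      rw [this]
      by_cases hmU : m ∈ U
      · rw [Finset.card_erase_of_mem hmU]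
        have : U.card ≠ 2 := fun h => hm h hmU
        omega
      · rwa [Finset.erase_eq_of_notMem hmU]
    have hex : ∃ m m', m ≠ m' ∧ (U.card = 2 → m ∉ U) ∧ (U.card = 2 → m' ∉ U) := by
      by_cases h2 : U.card = 2
      · have hc : 1 < Uᶜ.card := by rw [Finset.card_compl]; omega
        obtain ⟨m, hm, m', hm', hne⟩ := Finset.one_lt_card.1 hc
        exact ⟨m, m', hne, fun _ => Finset.mem_compl.1 hm, fun _ => Finset.mem_compl.1 hm'⟩
      · obtain ⟨m, m', hne⟩ := Fintype.exists_pair_of_one_lt_card (α := κ) (by omega)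
        exact ⟨m, m', hne, fun h => absurd h h2, fun h => absurd h h2⟩
    obtain ⟨m, m', hne, hm, hm'⟩ := hex
    exact ⟨m, m', hne, hsing m hm, hsing m' hm'⟩

/-! ### Embedding expansions of forests -/

/-- A finite nonempty forest has a vertex with at most one neighbour. -/
theorem SimpleGraph.IsAcyclic.exists_neighbor_unique {W : Type*} [Finite W] [Nonempty W]
    {G : SimpleGraph W} (hG : G.IsAcyclic) : ∃ w, ∀ a b, G.Adj w a → G.Adj w b → a = b := by
  classical
  have := Fintype.ofFinite W
  rcases subsingleton_or_nontrivial W with h | h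
  · exact ⟨Classical.arbitrary W, fun a b _ _ => Subsingleton.elim a b⟩
  · obtain ⟨T, hGT, -, hT⟩ := SimpleGraph.Connected.exists_isTree_le_of_le_of_isAcyclic
      (SimpleGraph.connected_top (V := W)) le_top hG
    obtain ⟨w, hw⟩ := hT.exists_vert_degree_one_of_nontrivial
    refine ⟨w, fun a b ha hb => ?_⟩
    rw [← SimpleGraph.card_neighborFinset_eq_degree, Finset.card_eq_one] at hw
    obtain ⟨c, hc⟩ := hw
    have h1 : a ∈ T.neighborFinset w := by simpa using hGT ha
    have h2 : b ∈ T.neighborFinset w := by simpa using hGT hb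
    rw [hc, Finset.mem_singleton] at h1 h2
    rw [h1, h2]

theorem SimpleGraph.IsAcyclic.exists_mem_neighbor_unique {W : Type*} {G : SimpleGraph W}
    (hG : G.IsAcyclic) {P : Finset W} (hP : P.Nonempty) :
    ∃ w ∈ P, ∀ a ∈ P, ∀ b ∈ P, G.Adj w a → G.Adj w b → a = b := by
  obtain ⟨p, hp⟩ := hP
  have : Nonempty (P : Set W) := ⟨⟨p, hp⟩⟩
  obtain ⟨w, hw⟩ := (hG.induce (P : Set W)).exists_neighbor_unique
  exact ⟨w, w.2, fun a ha b hb hwa hwb =>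
    congrArg Subtype.val (hw ⟨a, ha⟩ ⟨b, hb⟩ (by simpa using hwa) (by simpa using hwb))⟩

section Embedding

variable {V W : Type*} [DecidableEq V] {r : ℕ}

/-- A copy in `H` of the expansion of the subgraph of `G` induced on `P`: the vertices of `P` are
mapped by `φ` to vertices of `H` with colours in `C`, and the edge `e` of `G` is expanded to the
edge `E e` of `H`. All these edges and vertices lie in `X`. -/
structure IsPartialExpansion (G : SimpleGraph W) (H : Finset (Finset V)) (χ : V → Fin r)
    (C : Finset (Fin r)) (P : Finset W) (φ : W → V) (E : Sym2 W → Finset V) (X : Finset V) :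
    Prop where
  injOn : Set.InjOn φ P
  mem_X : ∀ p ∈ P, φ p ∈ X
  color_mem : ∀ p ∈ P, χ (φ p) ∈ C
  exists_edge : ∀ p ∈ P, ∃ e ∈ H, φ p ∈ e
  mem_H : ∀ e ∈ G.edgeSet, (∀ a ∈ e, a ∈ P) → E e ∈ H
  subset_X : ∀ e ∈ G.edgeSet, (∀ a ∈ e, a ∈ P) → E e ⊆ X
  mem_iff : ∀ e ∈ G.edgeSet, (∀ a ∈ e, a ∈ P) → ∀ c ∈ P, (φ c ∈ E e ↔ c ∈ e)
  inter : ∀ e ∈ G.edgeSet, (∀ a ∈ e, a ∈ P) → ∀ e' ∈ G.edgeSet, (∀ a ∈ e', a ∈ P) → e ≠ e' →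
    ∀ x ∈ E e, x ∈ E e' → ∃ p ∈ P, φ p = x

variable [DecidableEq W] {G : SimpleGraph W} {H : Finset (Finset V)} {χ : V → Fin r}
  {C : Finset (Fin r)} {P : Finset W} {φ : W → V} {E : Sym2 W → Finset V} {X : Finset V}

/-- A vertex `w` with at most one neighbour in `P` can be mapped to a new vertex `z` of an edge `g`
which meets the earlier part of the copy at most in the image of that neighbour. -/
theorem IsPartialExpansion.extend (h : IsPartialExpansion G H χ C P φ E X) {w : W} (hw : w ∉ P)
    {g : Finset V} (hg : g ∈ H) {z : V} (hzg : z ∈ g) (hzC : χ z ∈ C) (hzX : z ∉ X)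
    (hgX : ∀ x ∈ g, x ∈ X → ∃ p ∈ P, φ p = x)
    (hmem : ∀ a ∈ P, G.Adj w a → ∀ c ∈ P, (φ c ∈ g ↔ c = a))
    (huniq : ∀ a ∈ P, ∀ b ∈ P, G.Adj w a → G.Adj w b → a = b) :
    IsPartialExpansion G H χ C (insert w P) (Function.update φ w z)
      (fun e => if w ∈ e then g else E e) (X ∪ g) := by
  have hφ : ∀ p ∈ P, Function.update φ w z p = φ p := fun p hp =>
    Function.update_of_ne (by rintro rfl; exact hw hp) _ _
  have hold : ∀ e : Sym2 W, (∀ a ∈ e, a ∈ insert w P) → w ∉ e → ∀ a ∈ e, a ∈ P := by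
    intro e he hwe a ha
    rcases Finset.mem_insert.1 (he a ha) with rfl | h
    · exact absurd ha hwe
    · exact h
  have hnew : ∀ e ∈ G.edgeSet, (∀ a ∈ e, a ∈ insert w P) → w ∈ e →
      ∃ a ∈ P, G.Adj w a ∧ e = s(w, a) := by
    intro e he heP hwe
    obtain ⟨a, rfl⟩ := Sym2.mem_iff_exists.1 hwe
    have hadj : G.Adj w a := he
    refine ⟨a, ?_, hadj, rfl⟩
    rcases Finset.mem_insert.1 (heP a (by simp)) with h | h
    · exact absurd h hadj.ne'
    · exact h
  constructor
  · intro a ha b hb hab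
    rcases Finset.mem_insert.1 (Finset.mem_coe.1 ha) with rfl | haP <;>
    rcases Finset.mem_insert.1 (Finset.mem_coe.1 hb) with rfl | hbP
    · rfl
    · rw [Function.update_self, hφ b hbP] at hab
      exact absurd (hab ▸ h.mem_X b hbP) hzX
    · rw [Function.update_self, hφ a haP] at hab
      exact absurd (hab ▸ h.mem_X a haP) hzX
    · rw [hφ a haP, hφ b hbP] at hab
      exact h.injOn haP hbP hab
  · intro p hp
    rcases Finset.mem_insert.1 hp with rfl | hp
    · rw [Function.update_self]; exact Finset.mem_union_right _ hzg
    · rw [hφ p hp]; exact Finset.mem_union_left _ (h.mem_X p hp)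
  · intro p hp
    rcases Finset.mem_insert.1 hp with rfl | hp
    · rwa [Function.update_self]
    · rw [hφ p hp]; exact h.color_mem p hp
  · intro p hp
    rcases Finset.mem_insert.1 hp with rfl | hp
    · rw [Function.update_self]; exact ⟨g, hg, hzg⟩
    · rw [hφ p hp]; exact h.exists_edge p hp
  · intro e he heP
    split_ifs with hwe
    · exact hg
    · exact h.mem_H e he (hold e heP hwe)
  · intro e he heP
    split_ifs with hwe
    · exact Finset.subset_union_right
    · exact (h.subset_X e he (hold e heP hwe)).trans Finset.subset_union_left
  · intro e he heP c hc
    split_ifs with hwe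
    · obtain ⟨a, ha, hwa, rfl⟩ := hnew e he heP hwe
      rcases Finset.mem_insert.1 hc with rfl | hcP
      · simp [hzg]
      · rw [hφ c hcP, hmem a ha hwa c hcP, Sym2.mem_iff]
        constructor
        · exact Or.inr
        · rintro (rfl | h)
          · exact absurd hcP hw
          · exact h
    · have heP' := hold e heP hwe
      rcases Finset.mem_insert.1 hc with rfl | hcP
      · rw [Function.update_self]
        exact ⟨fun hz => absurd (h.subset_X e he heP' hz) hzX, fun hz => absurd hz hwe⟩
      · rw [hφ c hcP]
        exact h.mem_iff e he heP' c hcP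
  · have lift : ∀ x, (∃ p ∈ P, φ p = x) → ∃ p ∈ insert w P, Function.update φ w z p = x := by
      rintro x ⟨p, hp, rfl⟩
      exact ⟨p, Finset.mem_insert_of_mem hp, hφ p hp⟩
    intro e he heP e' he' heP' hne x hx hx'
    apply lift
    split_ifs at hx hx' with hwe hwe' hwe'
    · obtain ⟨a, ha, hwa, rfl⟩ := hnew e he heP hwe
      obtain ⟨b, hb, hwb, rfl⟩ := hnew e' he' heP' hwe'
      exact absurd (by rw [huniq a ha b hb hwa hwb]) hne
    · exact hgX x hx (h.subset_X e' he' (hold e' heP' hwe') hx')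
    · exact hgX x hx' (h.subset_X e he (hold e heP hwe) hx)
    · exact h.inter e he (hold e heP hwe) e' he' (hold e' heP' hwe') hne x hx hx'

theorem IsPartialExpansion.containsCopy [Fintype W] (hH : IsRGraph r H) (hr : 2 ≤ r)
    (h : IsPartialExpansion G H χ C Finset.univ φ E X) : ContainsCopy (expansion G r) H := by
  have hcard2 : ∀ e : G.edgeSet, ((e : Sym2 W).toFinset).card = 2 := fun e =>
    Sym2.card_toFinset_of_not_isDiag _ (G.not_isDiag_of_mem_edgeSet e.2)
  have hinj : Function.Injective φ := fun a b hab => h.injOn (by simp) (by simp) hab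
  have hmem : ∀ e : G.edgeSet, ∀ c, φ c ∈ E e ↔ c ∈ (e : Sym2 W) := fun e c =>
    h.mem_iff e e.2 (by simp) c (by simp)
  have hEH : ∀ e : G.edgeSet, E e ∈ H := fun e => h.mem_H e e.2 (by simp)
  have hrest : ∀ e : G.edgeSet, (E e \ (e : Sym2 W).toFinset.image φ).card = r - 2 := by
    intro e
    rw [Finset.card_sdiff_of_subset, Finset.card_image_of_injective _ hinj, hcard2, hH _ (hEH e)]
    intro x hx
    obtain ⟨c, hc, rfl⟩ := Finset.mem_image.1 hx
    exact (hmem e c).2 (by simpa using hc)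
  let ψ : ∀ e : G.edgeSet, Fin (r - 2) ≃ ↥(E e \ (e : Sym2 W).toFinset.image φ) := fun e =>
    (Finset.equivFinOfCardEq (hrest e)).symm
  have hψE : ∀ (e : G.edgeSet) i, (ψ e i : V) ∈ E e := fun e i => (Finset.mem_sdiff.1 (ψ e i).2).1
  have hψφ : ∀ (e : G.edgeSet) i c, (ψ e i : V) ≠ φ c := by
    intro e i c hc
    have h2 := Finset.mem_sdiff.1 (ψ e i).2
    rw [hc] at h2
    exact h2.2 (Finset.mem_image_of_mem _ (by simpa using (hmem e c).1 h2.1))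
  let Φ : W ⊕ (G.edgeSet × Fin (r - 2)) → V := Sum.elim φ fun p => ψ p.1 p.2
  have hΦ : Function.Injective Φ := by
    rintro (a | ⟨e, i⟩) (b | ⟨e', j⟩) hab
    · exact congrArg _ (hinj hab)
    · exact absurd hab.symm (hψφ e' j a)
    · exact absurd hab (hψφ e i b)
    · have hab' : (ψ e i : V) = ψ e' j := hab
      by_cases hee : e = e'
      · subst hee
        rw [(ψ e).injective (Subtype.ext hab')]
      · obtain ⟨p, -, hp⟩ := h.inter e e.2 (by simp) e' e'.2 (by simp)
          (fun h => hee (Subtype.ext h)) _ (hψE e i) (hab' ▸ hψE e' j)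
        exact absurd hp.symm (hψφ e i p)
  refine ⟨⟨Φ, hΦ⟩, ?_⟩
  rintro _ ⟨e, rfl⟩
  have hedge : (expansionEdge G r e).map ⟨Φ, hΦ⟩ = E e := by
    apply Finset.eq_of_subset_of_card_le
    · intro x hx
      obtain ⟨y, hy, rfl⟩ := Finset.mem_map.1 hx
      rcases y with c | ⟨e', i⟩
      · exact (hmem e c).2 (by simpa [expansionEdge] using hy)
      · obtain rfl : e = e' := by simpa [expansionEdge] using hy
        exact hψE e i
    · rw [hH _ (hEH e), Finset.card_map, expansionEdge, Finset.card_disjSum, hcard2]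
      simp
      omega
  rw [hedge]
  exact hEH e

variable [Fintype V]

/-- If `{m}` and `{m'}` are types of a homogeneous family, then the expansion of a forest can be
embedded greedily, with the vertices of the forest in the colour classes of `m` and `m'`: a vertex
of these colours is the core of a large Delta-system, in which an edge avoiding the part of the copy
built so far is found. -/
theorem IsHomogeneous.exists_isPartialExpansion {s : ℕ} (hH : IsRainbow χ H)
    (hom : IsHomogeneous s χ H) (hne : H.Nonempty) {m m' : Fin r} (hmm : m ≠ m')
    (hm : {m} ∈ intersectionTypes χ H) (hm' : {m'} ∈ intersectionTypes χ H)
    (hs : 2 * r < s) (hG : G.IsAcyclic) (P : Finset W) (hP : r * P.card < s) :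
    ∃ (φ : W → V) (E : Sym2 W → Finset V) (X : Finset V),
      IsPartialExpansion G H χ {m, m'} P φ E X ∧ X.card ≤ r * P.card := by
  obtain ⟨e₀, he₀⟩ := hne
  have hempty : ∅ ∈ intersectionTypes χ H := by
    have := hom.inter_mem hH hs hm hm'
    rwa [Finset.disjoint_iff_inter_eq_empty.1 (by simpa using hmm)] at this
  induction P using Finset.strongInduction with
  | H P ih =>
  rcases P.eq_empty_or_nonempty with rfl | hPne
  · obtain ⟨x₀, -⟩ := hH.exists_mem he₀ m
    have hno : ∀ e : Sym2 W, ¬ ∀ a ∈ e, a ∈ (∅ : Finset W) := fun e h => by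
      induction e with
      | _ a b => exact absurd (h a (by simp)) (by simp)
    exact ⟨fun _ => x₀, fun _ => ∅, ∅, ⟨by simp, by simp, by simp, by simp,
      fun e _ h => absurd h (hno e), fun e _ h => absurd h (hno e),
      fun e _ h => absurd h (hno e), fun e _ h => absurd h (hno e)⟩, by simp⟩
  obtain ⟨w, hwP, hw⟩ := hG.exists_mem_neighbor_unique hPne
  have hPc : (P.erase w).card + 1 = P.card := Finset.card_erase_add_one hwP
  have hrP : r * P.card = r * (P.erase w).card + r := by rw [← hPc]; ring
  obtain ⟨φ, E, X, h, hX⟩ := ih (P.erase w) (Finset.erase_ssubset hwP) (by omega)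
  have hXs : X.card < s := by omega
  have hw' : w ∉ P.erase w := Finset.notMem_erase w P
  have huniq : ∀ a ∈ P.erase w, ∀ b ∈ P.erase w, G.Adj w a → G.Adj w b → a = b := fun a ha b hb =>
    hw a (Finset.mem_of_mem_erase ha) b (Finset.mem_of_mem_erase hb)
  have hcard : ∀ g ∈ H, (X ∪ g).card ≤ r * P.card := fun g hg =>
    (Finset.card_union_le _ _).trans (by rw [(hH g hg).1]; omega)
  by_cases hu : ∃ u ∈ P.erase w, G.Adj w u
  · obtain ⟨u, huP, hwu⟩ := hu
    obtain ⟨e, he, hue⟩ := h.exists_edge u huP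
    have hcol := h.color_mem u huP
    have hproj : proj χ e {χ (φ u)} = {φ u} := by
      simpa using hH.proj_image he (Finset.singleton_subset_iff.2 hue)
    have hcore : s ≤ coreDegree H {φ u} := by
      rw [← hproj]
      apply hom _ _ e he
      rcases Finset.mem_insert.1 hcol with h | h
      · rwa [h]
      · rwa [Finset.mem_singleton.1 h]
    obtain ⟨g, hg, hug, hgX⟩ := exists_inter_subset_of_card_lt (lt_of_lt_of_le hXs hcore)
    have hgX' : ∀ x ∈ g, x ∈ X → x = φ u := fun x hxg hxX =>
      Finset.mem_singleton.1 (hgX (Finset.mem_inter.2 ⟨hxg, hxX⟩))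
    rw [Finset.singleton_subset_iff] at hug
    -- The new vertex has the other one of the two colours, so that it differs from `φ u`.
    obtain ⟨i, hi, hiu⟩ : ∃ i ∈ ({m, m'} : Finset (Fin r)), i ≠ χ (φ u) := by
      by_cases hc : m = χ (φ u)
      · exact ⟨m', by simp, fun h => hmm (hc.trans h.symm)⟩
      · exact ⟨m, by simp, hc⟩
    obtain ⟨z, hzg, rfl⟩ := hH.exists_mem hg i
    have hzX : z ∉ X := fun hz => hiu (by rw [hgX' z hzg hz])
    have hmem : ∀ a ∈ P.erase w, G.Adj w a → ∀ c ∈ P.erase w, (φ c ∈ g ↔ c = a) := by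
      intro a ha hwa c hc
      rw [huniq a ha u huP hwa hwu]
      constructor
      · intro hcg
        exact h.injOn hc huP (hgX' _ hcg (h.mem_X c hc))
      · rintro rfl; exact hug
    have hext := h.extend hw' hg hzg hi hzX
      (fun x hx hxX => ⟨u, huP, (hgX' x hx hxX).symm⟩) hmem huniq
    rw [Finset.insert_erase hwP] at hext
    exact ⟨_, _, _, hext, hcard g hg⟩
  · obtain ⟨g, hg, -, hgX⟩ :=
      exists_inter_subset_of_card_lt (lt_of_lt_of_le hXs (hom ∅ hempty e₀ he₀))
    have hgX' : ∀ x ∈ g, x ∉ X := fun x hxg hxX => by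
      have := mem_proj.1 (hgX (Finset.mem_inter.2 ⟨hxg, hxX⟩))
      simp at this
    obtain ⟨z, hzg, rfl⟩ := hH.exists_mem hg m
    have hext := h.extend hw' hg hzg (by simp) (hgX' z hzg)
      (fun x hx hxX => absurd hxX (hgX' x hx)) (fun a ha hwa => absurd ⟨a, ha, hwa⟩ hu) huniq
    rw [Finset.insert_erase hwP] at hext
    exact ⟨_, _, _, hext, hcard g hg⟩

end Embedding

/-! ### The partition -/

section Partition

variable {V : Type*} [Fintype V] [DecidableEq V] {r s : ℕ} {χ : V → Fin r}
  {H : Finset (Finset V)}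

/-- If some `r - 2` colours are not contained in a type of `H`, then the edges of `H` are determined
by their vertices of these colours. -/
theorem IsRainbow.card_le_choose_of_not_subset (hH : IsRainbow χ H) (B : Finset (Fin r))
    (hB : ∀ A ∈ intersectionTypes χ H, ¬ B ⊆ A) :
    H.card ≤ (Fintype.card V).choose B.card := by
  rw [← Finset.card_univ, ← Finset.card_powersetCard]
  apply Finset.card_le_card_of_injOn fun e => proj χ e B
  · intro e he
    exact Finset.mem_powersetCard.2 ⟨Finset.subset_univ _, hH.card_proj he B⟩
  · intro e he e' he' hee
    by_contra hne
    refine hB _ (mem_intersectionTypes.2 ⟨e, he, e', he', hne, rfl⟩) ?_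
    rw [← hH.image_proj he B]
    exact Finset.image_subset_image (proj_subset_inter hee)

/-- A homogeneous family is small, or has all the pairs of colours through some colour, or two
single colours, among its types. -/
theorem IsHomogeneous.card_le_or_star_or_singletons (hH : IsRainbow χ H)
    (hom : IsHomogeneous s χ H) (hr : 4 ≤ r) (hs : 2 * r < s) :
    H.card ≤ (Fintype.card V).choose (r - 2) ∨
      (∃ i, ∀ j, j ≠ i → {i, j} ∈ intersectionTypes χ H) ∨
      ∃ m m', m ≠ m' ∧ {m} ∈ intersectionTypes χ H ∧ {m'} ∈ intersectionTypes χ H := by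
  by_cases hown : ∃ B : Finset (Fin r), B.card = r - 2 ∧ ∀ A ∈ intersectionTypes χ H, ¬ B ⊆ A
  · obtain ⟨B, hBc, hB⟩ := hown
    exact Or.inl (hBc ▸ hH.card_le_choose_of_not_subset B hB)
  · push Not at hown
    refine Or.inr (exists_star_or_singletons (by simpa using hr)
      (fun A hA B hB => hom.inter_mem hH hs hA hB) fun a b hab => ?_)
    obtain ⟨A, hA, hBA⟩ := hown ({a, b}ᶜ) (by
      rw [Finset.card_compl, Finset.card_pair hab, Fintype.card_fin])
    have hsub : Aᶜ ⊆ {a, b} := by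
      rw [← compl_compl ({a, b} : Finset (Fin r))]
      exact Finset.compl_subset_compl.2 hBA
    have hne : Aᶜ ≠ ∅ := by
      rw [Ne, Finset.compl_eq_empty_iff]
      exact hH.ne_univ hA
    have hcases : Aᶜ = ∅ ∨ Aᶜ = {a} ∨ Aᶜ = {b} ∨ Aᶜ = {a, b} := by
      have := Set.subset_pair_iff_eq.1 (show ((Aᶜ : Finset (Fin r)) : Set (Fin r)) ⊆ {a, b} by
        simpa only [Finset.coe_pair] using Finset.coe_subset.2 hsub)
      exact_mod_cast this
    rcases hcases with h | h | h | h
    · exact absurd h hne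
    · left; rwa [← h, compl_compl]
    · right; left; rwa [← h, compl_compl]
    · right; right; rwa [← h, compl_compl]

theorem IsHomogeneous.exists_le_coreDegree_pair (hH : IsRainbow χ H) (hom : IsHomogeneous s χ H)
    {i : Fin r} (hi : ∀ j, j ≠ i → {i, j} ∈ intersectionTypes χ H) {f : Finset V} (hf : f ∈ H) :
    ∃ x ∈ f, ∀ y ∈ f \ {x}, s ≤ coreDegree H {x, y} := by
  obtain ⟨x, hx, rfl⟩ := hH.exists_mem hf i
  refine ⟨x, hx, fun y hy => ?_⟩
  rw [Finset.mem_sdiff, Finset.mem_singleton] at hy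
  have hne : χ y ≠ χ x := fun h => hy.2 ((hH f hf).2 hy.1 hx h)
  have hproj : proj χ f {χ x, χ y} = {x, y} := by
    have := hH.proj_image (f := {x, y}) hf (by
      intro z hz
      rw [Finset.mem_insert, Finset.mem_singleton] at hz
      rcases hz with rfl | rfl
      · exact hx
      · exact hy.1)
    simpa using this
  rw [← hproj]
  exact hom _ (hi _ hne) f hf

end Partition

theorem Nat.choose_succ_le_mul_choose {n k : ℕ} (h : k ≤ n) :
    (n + 1).choose k ≤ (k + 1) * n.choose k := by
  have h1 := Nat.choose_mul_succ_eq n k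
  obtain ⟨d, rfl⟩ := Nat.exists_eq_add_of_le h
  have h2 : k + d + 1 - k = d + 1 := by omega
  rw [h2] at h1
  refine Nat.le_of_mul_le_mul_right ?_ (Nat.succ_pos d)
  rw [Nat.succ_eq_add_one, ← h1]
  nlinarith [Nat.zero_le ((k + d).choose k * (k * d))]

theorem Nat.choose_le_mul_choose_sub_two {n r : ℕ} (hr : 2 ≤ r) (h : r ≤ n) :
    n.choose (r - 2) ≤ r ^ 2 * (n - 2).choose (r - 2) := by
  obtain ⟨k, rfl⟩ := Nat.exists_eq_add_of_le' hr
  obtain ⟨d, rfl⟩ := Nat.exists_eq_add_of_le h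
  have e1 : k + 2 + d = k + d + 1 + 1 := by omega
  have e2 : k + 2 + d - 2 = k + d := by omega
  rw [e2, e1, Nat.add_sub_cancel]
  calc (k + d + 1 + 1).choose k ≤ (k + 1) * ((k + 1) * (k + d).choose k) :=
        (Nat.choose_succ_le_mul_choose (by omega)).trans
          (Nat.mul_le_mul_left _ (Nat.choose_succ_le_mul_choose (by omega)))
    _ = (k + 1) ^ 2 * (k + d).choose k := by ring
    _ ≤ (k + 2) ^ 2 * (k + d).choose k := by gcongr; omega

theorem mainTheorem7 (v r : ℕ) (hv : 1 ≤ v) (hr : 4 ≤ r) :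
    ∃ c : ℝ, ∀ (n : ℕ) (V : Type*) [Fintype V] [DecidableEq V] (W : Type*) [Fintype W]
      [DecidableEq W] (H : Finset (Finset V)) (G : SimpleGraph W),
      Fintype.card V = n → IsRGraph r H →
      Fintype.card W = v → G.IsAcyclic →
      ¬ ContainsCopy (expansion G r) H →
      ∃ H₁ H₂ : Finset (Finset V), Disjoint H₁ H₂ ∧ H₁ ∪ H₂ = H ∧
        (H₁.card : ℝ) ≤ c * ((n - 2).choose (r - 2) : ℝ) ∧
        ∀ f ∈ H₂, ∃ x ∈ f, ∀ y ∈ f \ {x}, r * v ≤ coreDegree H₂ {x, y} := by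
  -- Large enough both for `IsHomogeneous.inter_mem` and for embedding an expansion of `v` vertices.
  set s := r * v + 2 * r + 1 with hs
  obtain ⟨N, hN⟩ := exists_isHomogeneous r s (by omega) (by omega)
  refine ⟨((N * r ^ 2 : ℕ) : ℝ), fun n V _ _ W _ _ H G hn hH hW hG hcopy => ?_⟩
  -- `H₂` is a maximal subfamily with the required property; the property is preserved by unions.
  let Q : Finset (Finset V) → Prop := fun K =>
    K ⊆ H ∧ ∀ f ∈ K, ∃ x ∈ f, ∀ y ∈ f \ {x}, r * v ≤ coreDegree K {x, y}
  obtain ⟨H₂, ⟨hH₂, hstar⟩, hmax⟩ := (Set.toFinite {K | Q K}).exists_maximal ⟨∅, by simp [Q]⟩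
  refine ⟨H \ H₂, H₂, Finset.sdiff_disjoint, Finset.sdiff_union_of_subset hH₂, ?_, hstar⟩
  rw [← Nat.cast_mul, Nat.cast_le]
  rcases (H \ H₂).eq_empty_or_nonempty with hR | ⟨e₀, he₀⟩
  · simp [hR]
  have hrn : r ≤ n := by
    rw [← hH e₀ (Finset.sdiff_subset he₀), ← hn]
    exact Finset.card_le_univ _
  obtain ⟨χ, K, hKR, hrain, hom, hcard⟩ := hN V (H \ H₂) fun e he => hH e (Finset.sdiff_subset he)
  have hKH : K ⊆ H := hKR.trans Finset.sdiff_subset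
  have hKne : K.Nonempty := by
    rw [Finset.nonempty_iff_ne_empty]
    rintro rfl
    rw [Finset.card_empty, mul_zero, Nat.le_zero, Finset.card_eq_zero] at hcard
    simp [hcard] at he₀
  rcases hom.card_le_or_star_or_singletons hrain hr (by omega) with
    hsmall | ⟨i, hi⟩ | ⟨m, m', hne, hm, hm'⟩
  · calc (H \ H₂).card ≤ N * (r ^ 2 * (n - 2).choose (r - 2)) :=
          hcard.trans (Nat.mul_le_mul_left _ ((hn ▸ hsmall).trans
            (Nat.choose_le_mul_choose_sub_two (by omega) hrn)))
      _ = N * r ^ 2 * (n - 2).choose (r - 2) := by ring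
  · have hQ : Q (H₂ ∪ K) := by
      refine ⟨Finset.union_subset hH₂ hKH, fun f hf => ?_⟩
      rcases Finset.mem_union.1 hf with hf | hf
      · obtain ⟨x, hx, h⟩ := hstar f hf
        exact ⟨x, hx, fun y hy => (h y hy).trans (coreDegree_mono Finset.subset_union_left _)⟩
      · obtain ⟨x, hx, h⟩ := hom.exists_le_coreDegree_pair hrain hi hf
        exact ⟨x, hx, fun y hy => (show r * v ≤ s by omega).trans
          ((h y hy).trans (coreDegree_mono Finset.subset_union_right _))⟩
    obtain ⟨e, he⟩ := hKne
    have he₂ : e ∈ H₂ := hmax hQ Finset.subset_union_left (Finset.mem_union_right _ he)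
    exact absurd he₂ (Finset.mem_sdiff.1 (hKR he)).2
  · obtain ⟨φ, E, X, h, -⟩ := hom.exists_isPartialExpansion hrain hKne hne hm hm' (by omega) hG
      Finset.univ (by rw [Finset.card_univ, hW]; omega)
    obtain ⟨ψ, hψ⟩ := h.containsCopy (fun e he => (hrain e he).1) (by omega)
    exact absurd ⟨ψ, fun f hf => hKH (hψ f hf)⟩ hcopy
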